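/- Let $k$ be a commutative domain; tensor products are over $k$, algebras are associative and unital, and $\eta_C,\mu_C$ denote the unit and the multiplication of an algebra $C$. A *twisting map* for $k$-algebras $A,B$ is a $k$-linear map $s\colon B\otimes A\to A\otimes B$ such that $$s\circ(\eta_B\otimes A)=A\otimes\eta_B,\qquad s\circ(B\otimes\eta_A)=\eta_A\otimes B,$$ $$s\circ(\mu_B\otimes A)=(A\otimes\mu_B)\circ(s\otimes B)\circ(B\otimes s),\qquad s\circ(B\otimes\mu_A)=(\mu_A\otimes B)\circ(A\otimes s)\circ(s\otimes A).$$ For a twisting map $s\colon k[Y]\otimes k[X]\to k[X]\otimes k[Y]$ let $\alpha_n\colon k[X]\to k[X]$ ($n\ge 0$) be the maps defined by $s(Y\otimes a)=\sum_n\alpha_n(a)\otimes Y^n$. The map $s$ is *upper bounded* if there exists $n_0$ such that $\alpha_n=0$ for all $n\ge n_0$, and *lower bounded* if $\tau\circ s\circ\tau\colon k[X]\otimes k[Y]\to k[Y]\otimes k[X]$ is upper bounded (with the roles of $X$ and $Y$ exchanged), where $\tau$ denotes the flip. Let $\sum_{i,j}q_{ij}X^i\otimes Y^j\in k[X]\otimes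 k[Y]$. (1) If $q_{i0}=q_{i1}=0$ for all $i\ge 0$ and there is an upper bounded twisting map $s\colon k[Y]\otimes k[X]\to k[X]\otimes k[Y]$ with $s(Y\otimes X)=\sum_{i,j}q_{ij}X^i\otimes Y^j$, then $q_{0j}=q_{1j}=0$ for all $j\ge 0$; moreover, $s$ is the only twisting map with this value at $Y\otimes X$. (2) If $q_{0j}=q_{1j}=0$ for all $j\ge 0$ and there is a lower bounded twisting map $s\colon k[Y]\otimes k[X]\to k[X]\otimes k[Y]$ with $s(Y\otimes X)=\sum_{i,j}q_{ij}X^i\otimes Y^j$, then $q_{i0}=q_{i1}=0$ for all $i\ge 0$; moreover, $s$ is the only twisting map with this value at $Y\otimes X$. -/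

import Mathlib

open scoped TensorProduct

/-- A `k`-linear map `s : B ⊗ A → A ⊗ B` between tensor products of (associative, unital)
`k`-algebras is a twisting map when it is compatible with the units and the multiplications. -/
structure IsTwistingMap {k A B : Type*} [CommRing k] [Ring A] [Algebra k A] [Ring B] [Algebra k B]
    (s : B ⊗[k] A →ₗ[k] A ⊗[k] B) : Prop where
  /-- `s ∘ (η_B ⊗ A) = A ⊗ η_B` -/
  one_tmul : ∀ a : A, s ((1 : B) ⊗ₜ[k] a) = a ⊗ₜ[k] (1 : B)
  /-- `s ∘ (B ⊗ η_A) = η_A ⊗ B` -/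
  tmul_one : ∀ b : B, s (b ⊗ₜ[k] (1 : A)) = (1 : A) ⊗ₜ[k] b
  /-- `s ∘ (μ_B ⊗ A) = (A ⊗ μ_B) ∘ (s ⊗ B) ∘ (B ⊗ s)` -/
  mul_left : s ∘ₗ (LinearMap.mul' k B).rTensor A =
    (LinearMap.mul' k B).lTensor A ∘ₗ (TensorProduct.assoc k A B B).toLinearMap ∘ₗ
      s.rTensor B ∘ₗ (TensorProduct.assoc k B A B).symm.toLinearMap ∘ₗ
      s.lTensor B ∘ₗ (TensorProduct.assoc k B B A).toLinearMap
  /-- `s ∘ (B ⊗ μ_A) = (μ_A ⊗ B) ∘ (A ⊗ s) ∘ (s ⊗ A)` -/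
  mul_right : s ∘ₗ (LinearMap.mul' k A).lTensor B =
    (LinearMap.mul' k A).rTensor B ∘ₗ (TensorProduct.assoc k A A B).symm.toLinearMap ∘ₗ
      s.lTensor A ∘ₗ (TensorProduct.assoc k A B A).toLinearMap ∘ₗ
      s.rTensor A ∘ₗ (TensorProduct.assoc k B A A).symm.toLinearMap

namespace TwistingMap

/-- The maps `α_n : A → A` determined by `s (Y ⊗ a) = ∑ n, α_n a ⊗ Y ^ n`: apply
`A ⊗ (coefficient of Y ^ n) : A ⊗ k[Y] → A ⊗ k = A` to `s (Y ⊗ a)`. -/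
noncomputable def alpha {k A : Type*} [CommRing k] [Ring A] [Algebra k A]
    (s : Polynomial k ⊗[k] A →ₗ[k] A ⊗[k] Polynomial k) (n : ℕ) : A →ₗ[k] A :=
  (TensorProduct.rid k A).toLinearMap ∘ₗ (Polynomial.lcoeff k n).lTensor A ∘ₗ
    s ∘ₗ TensorProduct.mk k (Polynomial k) A Polynomial.X

/-- `s` is upper bounded: `α_n = 0` for all large `n`. -/
def IsUpperBounded {k A : Type*} [CommRing k] [Ring A] [Algebra k A]
    (s : Polynomial k ⊗[k] A →ₗ[k] A ⊗[k] Polynomial k) : Prop :=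
  ∃ n₀ : ℕ, ∀ n ≥ n₀, alpha s n = 0

/-- The map `τ ∘ s ∘ τ : A ⊗ B → B ⊗ A`, where `τ` denotes the flips. -/
noncomputable def flipConj {k A B : Type*} [CommRing k] [Ring A] [Algebra k A] [Ring B]
    [Algebra k B] (s : B ⊗[k] A →ₗ[k] A ⊗[k] B) : A ⊗[k] B →ₗ[k] B ⊗[k] A :=
  (TensorProduct.comm k A B).toLinearMap ∘ₗ s ∘ₗ (TensorProduct.comm k A B).toLinearMap

/-- `s : k[Y] ⊗ k[X] → k[X] ⊗ k[Y]` is lower bounded: `τ ∘ s ∘ τ` is upper bounded (here the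
variables `X` and `Y` are exchanged). -/
def IsLowerBounded {k : Type*} [CommRing k]
    (s : Polynomial k ⊗[k] Polynomial k →ₗ[k] Polynomial k ⊗[k] Polynomial k) : Prop :=
  IsUpperBounded (flipConj s)

/-- The element `∑ q_ij X ^ i ⊗ Y ^ j` of `k[X] ⊗ k[Y]` for a finitely supported family `q`. -/
noncomputable def ofCoeffs {k : Type*} [CommRing k] (q : ℕ × ℕ →₀ k) :
    Polynomial k ⊗[k] Polynomial k :=
  q.sum fun ij c => c • ((Polynomial.X ^ ij.1 : Polynomial k) ⊗ₜ[k]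
    (Polynomial.X ^ ij.2 : Polynomial k))

end TwistingMap

/-!
A twisting map `s : k[Y] ⊗ k[X] → k[X] ⊗ k[Y]` is the same as a multiplication on `k[X] ⊗ k[Y]` in
which `Y ^ r * a` has the normal form `F r a = s (Y ^ r ⊗ a)`; identifying `k[X] ⊗ k[Y]` with
`k[X][Y]`, the axioms of a twisting map become recursions for the coefficients of `F`
(`IsNormalForm`).

Suppose that `Y * X` has order at least `2` in `Y`. Then `F r a` has order at least `r` in `Y`, and
order at least `r + 1` if `r ≥ 1` and `X` divides `a`. With this triangularity the coefficient of
`Y ^ m` in `Y * X ^ i` can be computed from `Y * X` by induction on `m`, which gives uniqueness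
(`IsNormalForm.eq_of_apply_X_eq`). Moreover `Y * X ^ N` has order at least `N + 1`, so that it
vanishes for large `N` if `s` is upper bounded (`IsNormalForm.exists_apply_X_pow_eq_zero`).

This vanishing forces `X ^ 2` to divide `Y * X`, in two steps. Work first modulo `X`, that is, in the
right module `C / X C ≅ k[Y]` of the twisted tensor product `C`. If `Y * X` were nonzero there with
lowest term `c * Y ^ (s + 1)`, then `Y * X ^ i` would have the lowest term `c ^ i * Y ^ (1 + i * s)`
(`IsNormalForm.coeff_coeff_zero_X_pow`), which is nonzero for all `i`. So `Y * X = X * g(Y)` modulo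
`X ^ 2`, and then `Y * X ^ i = X ^ i * g^[i](Y)` modulo `X ^ (i + 1)`, with `g^[i]` the iterated
composite (`IsNormalForm.coeff_swap_apply_X_pow`); since `g(0) = 0` and `k` is a domain, this
vanishes for some `i` only if `g = 0`.

The lower bounded case follows by passing to the opposite algebra, that is, by conjugating `s` with
the flips (`isTwistingMap_flipConj`).
-/

namespace TwistingMap

open Polynomial

/-- `F r a : k[X][Y]` is the normal form `∑ n, c n * Y ^ n`, with the `c n : k[X]` on the left, of
the product `Y ^ r * a` in a twisted tensor product `k[X] ⊗ k[Y]`.  The fields are the two unit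
laws, `Y ^ (r + 1) * a = Y ^ r * (Y * a)` and `Y ^ r * (a * b) = (Y ^ r * a) * b`. -/
structure IsNormalForm {k : Type*} [CommRing k] (F : ℕ → k[X] →ₗ[k] k[X][X]) : Prop where
  zero_apply : ∀ a, F 0 a = C a
  apply_one : ∀ r, F r 1 = X ^ r
  succ_apply : ∀ r a, F (r + 1) a = (F 1 a).sum fun n c => F r c * X ^ n
  apply_mul : ∀ r a b, F r (a * b) = (F r a).sum fun n c => C c * F n b

namespace IsNormalForm

variable {k : Type*} [CommRing k] {F F' : ℕ → k[X] →ₗ[k] k[X][X]}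

theorem coeff_succ (hF : IsNormalForm F) (r : ℕ) (a : k[X]) (j : ℕ) :
    (F (r + 1) a).coeff j =
      ∑ n ∈ Finset.range (j + 1), (F r ((F 1 a).coeff n)).coeff (j - n) := by
  rw [hF.succ_apply, Polynomial.sum_over_range' _ (by simp) ((F 1 a).natDegree + 1 + (j + 1))
    (by omega), finsetSum_coeff]
  symm
  refine Finset.sum_subset_zero_on_sdiff
    (Finset.range_mono (show j + 1 ≤ (F 1 a).natDegree + 1 + (j + 1) by omega)) ?_ ?_
  · intro n hn
    rw [Finset.mem_sdiff, Finset.mem_range, Finset.mem_range] at hn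
    rw [coeff_mul_X_pow', if_neg (by omega)]
  · intro n hn
    rw [Finset.mem_range] at hn
    rw [coeff_mul_X_pow', if_pos (by omega)]

theorem coeff_mul (hF : IsNormalForm F) (r : ℕ) (a b : k[X]) (j : ℕ) :
    (F r (a * b)).coeff j = (F r a).sum fun n c => c * (F n b).coeff j := by
  rw [hF.apply_mul, coeff_sum]
  simp only [coeff_C_mul]

/-! ### Triangularity -/

theorem coeff_one_zero (hF : IsNormalForm F) (h0 : (F 1 X).coeff 0 = 0) (a : k[X]) :
    (F 1 a).coeff 0 = 0 := by
  have hX : ∀ r, (F (r + 1) X).coeff 0 = 0 := fun r => by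
    rw [hF.coeff_succ]; simp [h0]
  have hpow : ∀ i, (F 1 (X ^ i)).coeff 0 = 0 := fun i => by
    induction i with
    | zero => simp [hF.apply_one]
    | succ i ih =>
      rw [pow_succ, hF.coeff_mul]
      refine Finset.sum_eq_zero fun n _ => ?_
      rcases n with _ | n
      · simp [ih]
      · simp [hX]
  induction a using Polynomial.induction_on' with
  | add p q hp hq => simp [hp, hq]
  | monomial i c => rw [← smul_X_eq_monomial, map_smul, coeff_smul, hpow, smul_zero]

/-- `F r a` is divisible by `Y ^ r`. -/
theorem coeff_eq_zero_of_lt (hF : IsNormalForm F) (h0 : (F 1 X).coeff 0 = 0) (r : ℕ) (a : k[X])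
    {j : ℕ} (hj : j < r) : (F r a).coeff j = 0 := by
  induction r generalizing a j with
  | zero => omega
  | succ r ih =>
    rw [hF.coeff_succ]
    refine Finset.sum_eq_zero fun n hn => ?_
    rw [Finset.mem_range] at hn
    rcases n with _ | n
    · simp [hF.coeff_one_zero h0]
    · exact ih _ (by omega)

/-- The product law as a sum of fixed length, available once `F` is triangular. -/
theorem coeff_mul_of_triangular (hF : IsNormalForm F) (h0 : (F 1 X).coeff 0 = 0) (r : ℕ)
    (a b : k[X]) (j : ℕ) :
    (F r (a * b)).coeff j =
      ∑ n ∈ Finset.range (j + 1), (F r a).coeff n * (F n b).coeff j := by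
  rw [hF.coeff_mul, Polynomial.sum_over_range' _ (by simp) ((F r a).natDegree + 1 + (j + 1))
    (by omega)]
  symm
  refine Finset.sum_subset
    (Finset.range_mono (show j + 1 ≤ (F r a).natDegree + 1 + (j + 1) by omega)) ?_
  intro n _ hn
  rw [Finset.mem_range] at hn
  rw [hF.coeff_eq_zero_of_lt h0 n b (by omega), mul_zero]

/-- For `r ≥ 1`, multiples of `X` are moved past `Y ^ r` at the cost of raising the order in `Y`. -/
theorem coeff_X_mul_eq_zero_of_le (hF : IsNormalForm F) (h0 : (F 1 X).coeff 0 = 0)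
    (h1 : (F 1 X).coeff 1 = 0) {r : ℕ} (hr : 1 ≤ r) (b : k[X]) {j : ℕ} (hj : j ≤ r) :
    (F r (X * b)).coeff j = 0 := by
  have hone : (F 1 (X * b)).coeff 1 = 0 := by
    rw [hF.coeff_mul_of_triangular h0]
    simp [Finset.sum_range_succ, h0, h1]
  obtain ⟨r, rfl⟩ : ∃ s, r = s + 1 := ⟨r - 1, by omega⟩
  rw [hF.coeff_succ]
  refine Finset.sum_eq_zero fun n hn => ?_
  rw [Finset.mem_range] at hn
  rcases n with _ | _ | n
  · simp [hF.coeff_one_zero h0]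
  · simp [hone]
  · exact hF.coeff_eq_zero_of_lt h0 _ _ (by omega)

/-! ### Uniqueness -/

/-- Agreement of `F 1` and `F' 1` below degree `m` in `Y` gives agreement of `F (r + 1)` and
`F' (r + 1)` below degree `m + r`, since the remaining factors `Y` only raise the degree. -/
theorem coeff_eq_of_coeff_one_eq (hF : IsNormalForm F) (hF' : IsNormalForm F')
    (h0 : (F 1 X).coeff 0 = 0) (h0' : (F' 1 X).coeff 0 = 0) {m : ℕ}
    (h : ∀ n < m, ∀ a, (F 1 a).coeff n = (F' 1 a).coeff n) (r : ℕ) (a : k[X]) {j : ℕ}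
    (hj : j < m + r) : (F (r + 1) a).coeff j = (F' (r + 1) a).coeff j := by
  induction r generalizing a j with
  | zero => exact h j (by omega) a
  | succ r ih =>
    rw [hF.coeff_succ, hF'.coeff_succ]
    refine Finset.sum_congr rfl fun n hn => ?_
    rcases n with _ | n
    · simp [hF.coeff_one_zero h0, hF'.coeff_one_zero h0']
    · by_cases hnm : n + 1 < m
      · rw [h _ hnm]
        exact ih _ (by omega)
      · rw [hF.coeff_eq_zero_of_lt h0 _ _ (by omega), hF'.coeff_eq_zero_of_lt h0' _ _ (by omega)]

/-- A normal form in which `Y * X` has order at least `2` in `Y` is determined by `Y * X`: the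
coefficient of `Y ^ m` in `Y * X ^ i * X` only involves coefficients of lower degree of the
`Y * a`. -/
theorem eq_of_apply_X_eq (hF : IsNormalForm F) (hF' : IsNormalForm F')
    (h0 : (F 1 X).coeff 0 = 0) (h1 : (F 1 X).coeff 1 = 0) (hX : F 1 X = F' 1 X) : F = F' := by
  have h0' : (F' 1 X).coeff 0 = 0 := hX ▸ h0
  have h1' : (F' 1 X).coeff 1 = 0 := hX ▸ h1
  have key : ∀ m a, (F 1 a).coeff m = (F' 1 a).coeff m := fun m => by
    induction m using Nat.strong_induction_on with
    | _ m ih =>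
    have hpow : ∀ i, (F 1 (X ^ i)).coeff m = (F' 1 (X ^ i)).coeff m := fun i => by
      rcases i with _ | i
      · simp [hF.apply_one, hF'.apply_one]
      rw [pow_succ, hF.coeff_mul_of_triangular h0, hF'.coeff_mul_of_triangular h0']
      refine Finset.sum_congr rfl fun n hn => ?_
      rw [Finset.mem_range] at hn
      rcases n with _ | n
      · simp [hF.coeff_one_zero h0, hF'.coeff_one_zero h0']
      rcases (show n + 1 < m ∨ n + 1 = m by omega) with hnm | hnm
      · rw [ih _ hnm]
        congr 1
        rcases n with _ | n
        · rw [zero_add, hX]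
        · exact hF.coeff_eq_of_coeff_one_eq hF' h0 h0' ih _ _ (by omega)
      · have hz := hF.coeff_X_mul_eq_zero_of_le h0 h1 (r := n + 1) (by omega) 1 hnm.ge
        have hz' := hF'.coeff_X_mul_eq_zero_of_le h0' h1' (r := n + 1) (by omega) 1 hnm.ge
        rw [mul_one] at hz hz'
        rw [hz, hz', mul_zero, mul_zero]
    intro a
    induction a using Polynomial.induction_on' with
    | add p q hp hq => simp [hp, hq]
    | monomial i c =>
      rw [← smul_X_eq_monomial, map_smul, map_smul, coeff_smul, coeff_smul, hpow]
  have hone : F 1 = F' 1 := LinearMap.ext fun a => Polynomial.ext fun m => key m a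
  funext r
  induction r with
  | zero => exact LinearMap.ext fun a => by rw [hF.zero_apply, hF'.zero_apply]
  | succ r ih => exact LinearMap.ext fun a => by rw [hF.succ_apply, hF'.succ_apply, ih, hone]

/-! ### Bounded normal forms -/

theorem coeff_X_pow_eq_zero_of_le (hF : IsNormalForm F) (h0 : (F 1 X).coeff 0 = 0)
    (h1 : (F 1 X).coeff 1 = 0) (i : ℕ) {j : ℕ} (hj : j ≤ i) : (F 1 (X ^ i)).coeff j = 0 := by
  induction i generalizing j with
  | zero => simp [hF.coeff_one_zero h0, show j = 0 by omega]
  | succ i ih =>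
    rw [pow_succ, hF.coeff_mul_of_triangular h0]
    refine Finset.sum_eq_zero fun n hn => ?_
    rw [Finset.mem_range] at hn
    by_cases hni : n ≤ i
    · rw [ih hni, zero_mul]
    · have hz := hF.coeff_X_mul_eq_zero_of_le h0 h1 (r := n) (by omega) 1 (j := j) (by omega)
      rw [mul_one] at hz
      rw [hz, mul_zero]

/-- If the order of `Y * X` in `Y` is at least `2` and the degrees in `Y` of all `Y * a` are
bounded, then `Y * X ^ N = 0` for some `N`, because `Y * X ^ N` has order at least `N + 1`. -/
theorem exists_apply_X_pow_eq_zero (hF : IsNormalForm F) (h0 : (F 1 X).coeff 0 = 0)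
    (h1 : (F 1 X).coeff 1 = 0) (hb : ∃ N, ∀ n ≥ N, ∀ a, (F 1 a).coeff n = 0) :
    ∃ N, F 1 (X ^ N) = 0 := by
  obtain ⟨N, hN⟩ := hb
  refine ⟨N, Polynomial.ext fun j => ?_⟩
  rcases le_total j N with hj | hj
  · rw [hF.coeff_X_pow_eq_zero_of_le h0 h1 N hj, coeff_zero]
  · rw [hN j hj, coeff_zero]

/-! ### Constant terms -/

/-- `Y ^ r * c`, split according to `c = X * divX c + c(0)`. -/
theorem apply_eq_add (hF : IsNormalForm F) (r : ℕ) (c : k[X]) :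
    F r c = F r (X * divX c) + c.coeff 0 • X ^ r := by
  conv_lhs => rw [← divX_mul_X_add c, ← mul_one (C (c.coeff 0)), ← smul_eq_C_mul]
  rw [map_add, map_smul, hF.apply_one, mul_comm]

/-- One step of the induction for `coeff_coeff_zero_of_lt`: up to the degree in which the remainders
`X * divX c` start to contribute, the constant terms of `Y ^ (r + 2) * X b` are those of
`Y * X b`, shifted by `r + 1`. -/
theorem coeff_coeff_zero_succ (hF : IsNormalForm F) (h0 : (F 1 X).coeff 0 = 0)
    (h1 : (F 1 X).coeff 1 = 0) {m r : ℕ}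
    (hr : ∀ b j, j < r + m → ((F (r + 1) (X * b)).coeff j).coeff 0 = 0) (b : k[X]) {j : ℕ}
    (hj : j ≤ r + 1 + m) :
    ((F (r + 2) (X * b)).coeff j).coeff 0 =
      if r + 1 ≤ j then ((F 1 (X * b)).coeff (j - (r + 1))).coeff 0 else 0 := by
  have hterm : ∀ n ∈ Finset.range (j + 1),
      ((F (r + 1) ((F 1 (X * b)).coeff n)).coeff (j - n)).coeff 0 =
        if r + 1 + n = j then ((F 1 (X * b)).coeff n).coeff 0 else 0 := fun n hn => by
    rw [Finset.mem_range] at hn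
    rcases Nat.lt_or_ge n 2 with hn2 | hn2
    · -- `Y * X b` has order at least `2` in `Y`.
      rw [hF.coeff_X_mul_eq_zero_of_le h0 h1 le_rfl b (show n ≤ 1 by omega)]
      simp
    · rw [hF.apply_eq_add, coeff_add, coeff_add, hr _ _ (by omega), zero_add, coeff_smul,
        coeff_X_pow]
      by_cases h : r + 1 + n = j
      · rw [if_pos h, if_pos (by omega)]
        simp
      · rw [if_neg h, if_neg (by omega)]
        simp
  rw [hF.coeff_succ, finsetSum_coeff, Finset.sum_congr rfl hterm]
  split_ifs with h
  · rw [Finset.sum_eq_single (j - (r + 1))]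
    · rw [if_pos (by omega)]
    · intro n _ hn
      rw [if_neg (by omega)]
    · intro hn
      rw [Finset.mem_range] at hn
      omega
  · exact Finset.sum_eq_zero fun n _ => if_neg (by omega)

/-- In the right module `C / X C ≅ k[Y]` of the twisted tensor product `C`, right multiplication by
a multiple of `X` raises the order of `Y ^ (r + 1)` by at least `m - 1`, where `m` is a lower bound
for the order of `Y * X`. -/
theorem coeff_coeff_zero_of_lt (hF : IsNormalForm F) (h0 : (F 1 X).coeff 0 = 0)
    (h1 : (F 1 X).coeff 1 = 0) {m : ℕ} (hm : ∀ j < m, ((F 1 X).coeff j).coeff 0 = 0) (r : ℕ)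
    (b : k[X]) {j : ℕ} (hj : j < r + m) : ((F (r + 1) (X * b)).coeff j).coeff 0 = 0 := by
  have hbase : ∀ b j, j < m → ((F 1 (X * b)).coeff j).coeff 0 = 0 := fun b j hj => by
    rw [hF.coeff_mul_of_triangular h0, finsetSum_coeff]
    refine Finset.sum_eq_zero fun n hn => ?_
    rw [Finset.mem_range] at hn
    rw [mul_coeff_zero, hm n (by omega), zero_mul]
  induction r generalizing b j with
  | zero => exact hbase b j (by omega)
  | succ r ih =>
    rw [hF.coeff_coeff_zero_succ h0 h1 (fun b j hj => ih b hj) b hj.le]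
    split_ifs with h
    · exact hbase b _ (by omega)
    · rfl

/-- If `c * Y ^ m` is the lowest term of `Y * X` modulo `X`, then `c * Y ^ (r + m)` is the lowest
term of `Y ^ (r + 1) * X`. -/
theorem coeff_coeff_zero_of_eq (hF : IsNormalForm F) (h0 : (F 1 X).coeff 0 = 0)
    (h1 : (F 1 X).coeff 1 = 0) {m : ℕ} (hm : ∀ j < m, ((F 1 X).coeff j).coeff 0 = 0) (r : ℕ) :
    ((F (r + 1) X).coeff (r + m)).coeff 0 = ((F 1 X).coeff m).coeff 0 := by
  rcases r with _ | r
  · rw [zero_add, zero_add]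
  · have h := hF.coeff_coeff_zero_succ h0 h1
      (fun b j hj => hF.coeff_coeff_zero_of_lt h0 h1 hm r b hj) 1 le_rfl
    rwa [mul_one, if_pos (by omega), show r + 1 + m - (r + 1) = m by omega] at h

/-- The lowest term `c * Y ^ (s + 1)` of `Y * X` modulo `X` gives the lowest term
`c ^ i * Y ^ (1 + i * s)` of `Y * X ^ i`. -/
theorem coeff_coeff_zero_X_pow (hF : IsNormalForm F) (h0 : (F 1 X).coeff 0 = 0)
    (h1 : (F 1 X).coeff 1 = 0) {s : ℕ} (hs : ∀ j < s + 1, ((F 1 X).coeff j).coeff 0 = 0) (i : ℕ) :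
    (∀ j < 1 + i * s, ((F 1 (X ^ i)).coeff j).coeff 0 = 0) ∧
      ((F 1 (X ^ i)).coeff (1 + i * s)).coeff 0 = ((F 1 X).coeff (s + 1)).coeff 0 ^ i := by
  induction i with
  | zero =>
    refine ⟨fun j hj => ?_, by simp [hF.apply_one]⟩
    rw [show j = 0 by omega, hF.coeff_one_zero h0, coeff_zero]
  | succ i ih =>
    have hz : ∀ n j, j < n + s → ((F 1 (X ^ i)).coeff n * (F n X).coeff j).coeff 0 = 0 :=
        fun n j hj => by
      rw [mul_coeff_zero]
      rcases n with _ | n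
      · rw [hF.coeff_one_zero h0, coeff_zero, zero_mul]
      · have h := hF.coeff_coeff_zero_of_lt h0 h1 hs n 1 (j := j) (by omega)
        rw [mul_one] at h
        rw [h, mul_zero]
    have hz' : ∀ n j, n < 1 + i * s → ((F 1 (X ^ i)).coeff n * (F n X).coeff j).coeff 0 = 0 :=
        fun n j hn => by
      rw [mul_coeff_zero, ih.1 n hn, zero_mul]
    rw [add_one_mul, pow_succ, ← add_assoc]
    constructor
    · intro j hj
      rw [hF.coeff_mul_of_triangular h0, finsetSum_coeff]
      refine Finset.sum_eq_zero fun n _ => ?_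
      rcases Nat.lt_or_ge n (1 + i * s) with hn | hn
      · exact hz' n j hn
      · exact hz n j (by omega)
    · rw [hF.coeff_mul_of_triangular h0, finsetSum_coeff, Finset.sum_eq_single (1 + i * s)]
      · rw [mul_coeff_zero, ih.2, pow_succ]
        congr 1
        have h := hF.coeff_coeff_zero_of_eq h0 h1 hs (i * s)
        rw [show i * s + 1 = 1 + i * s by omega,
          show i * s + (s + 1) = 1 + i * s + s by omega] at h
        exact h
      · intro n _ hn
        rcases Nat.lt_or_ge n (1 + i * s) with hn' | hn'
        · exact hz' n _ hn'
        · exact hz n _ (by omega)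
      · intro hn
        rw [Finset.mem_range] at hn
        omega

/-- If some `Y * X ^ N` vanishes, then `Y * X` is divisible by `X`: otherwise the coefficient
`c` of its lowest term modulo `X` gives the nonzero coefficient `c ^ N` of `Y * X ^ N`. -/
theorem coeff_coeff_zero_eq_zero [IsDomain k] (hF : IsNormalForm F) (h0 : (F 1 X).coeff 0 = 0)
    (h1 : (F 1 X).coeff 1 = 0) (hN : ∃ N, F 1 (X ^ N) = 0) (j : ℕ) :
    ((F 1 X).coeff j).coeff 0 = 0 := by
  obtain ⟨N, hN⟩ := hN
  induction j using Nat.strong_induction_on with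
  | _ j ih =>
  rcases j with _ | s
  · rw [h0, coeff_zero]
  · have h := (hF.coeff_coeff_zero_X_pow h0 h1 ih N).2
    rw [hN, coeff_zero, coeff_zero] at h
    exact eq_zero_of_pow_eq_zero h.symm

/-! ### Linear terms -/

theorem X_dvd_coeff (hF : IsNormalForm F) (h0 : (F 1 X).coeff 0 = 0)
    (hX : ∀ j, X ∣ (F 1 X).coeff j) (r : ℕ) (b : k[X]) (j : ℕ) :
    X ∣ (F r (X * b)).coeff j := by
  induction r generalizing b j with
  | zero =>
    rw [hF.zero_apply, coeff_C]
    split_ifs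
    · exact dvd_mul_right X b
    · exact dvd_zero X
  | succ r ih =>
    rw [hF.coeff_succ]
    refine Finset.dvd_sum fun n _ => ?_
    have h : X ∣ (F 1 (X * b)).coeff n := by
      rw [hF.coeff_mul_of_triangular h0]
      exact Finset.dvd_sum fun l _ => (hX l).mul_right _
    obtain ⟨c, hc⟩ := h
    rw [hc]
    exact ih c _

theorem X_pow_dvd_coeff (hF : IsNormalForm F) (h0 : (F 1 X).coeff 0 = 0)
    (hX : ∀ j, X ∣ (F 1 X).coeff j) (i r : ℕ) (b : k[X]) (j : ℕ) :
    X ^ i ∣ (F r (X ^ i * b)).coeff j := by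
  induction i generalizing r b j with
  | zero => simp
  | succ i ih =>
    rw [pow_succ', mul_assoc, hF.coeff_mul_of_triangular h0]
    refine Finset.dvd_sum fun n _ => mul_dvd_mul ?_ (ih n b j)
    simpa using hF.X_dvd_coeff h0 hX r 1 n

theorem coeff_coeff_swap (p : k[X][X]) (i j : ℕ) :
    ((Bivariate.swap p).coeff i).coeff j = (p.coeff j).coeff i := by
  induction p using Polynomial.induction_on' with
  | add p q hp hq => simp [hp, hq]
  | monomial n a =>
    rw [← C_mul_X_pow_eq_monomial, map_mul, map_pow, Bivariate.swap_Y, Bivariate.swap_C, ← C_pow,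
      Polynomial.coeff_mul_C, coeff_map, coeff_C_mul, coeff_C_mul, coeff_X_pow, coeff_X_pow]
    split_ifs <;> simp

theorem coeff_one_coeff_X_mul (hF : IsNormalForm F) (h0 : (F 1 X).coeff 0 = 0)
    (hX : ∀ j, X ∣ (F 1 X).coeff j) (r : ℕ) (c : k[X]) (j : ℕ) :
    ((F r (X * c)).coeff j).coeff 1 = c.coeff 0 * ((F r X).coeff j).coeff 1 := by
  have hc : X * c = X ^ 2 * divX c + c.coeff 0 • X := by
    conv_lhs => rw [← divX_mul_X_add c]
    rw [smul_eq_C_mul]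
    ring
  have h2 := X_pow_dvd_iff.1 (hF.X_pow_dvd_coeff h0 hX 2 r (divX c) j) 1 one_lt_two
  rw [hc, map_add, map_smul, coeff_add, coeff_smul, coeff_add, coeff_smul, h2, zero_add,
    smul_eq_mul]

/-- If `Y * X = X * g(Y)` modulo `X ^ 2`, then `Y ^ r * X = X * g(Y) ^ r` modulo `X ^ 2`. -/
theorem coeff_one_swap_apply_X (hF : IsNormalForm F) (h0 : (F 1 X).coeff 0 = 0)
    (hX : ∀ j, X ∣ (F 1 X).coeff j) (r : ℕ) :
    (Bivariate.swap (F r X)).coeff 1 = (Bivariate.swap (F 1 X)).coeff 1 ^ r := by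
  induction r with
  | zero => simp [hF.zero_apply, Bivariate.swap_C]
  | succ r ih =>
    rw [pow_succ', ← ih]
    ext j
    rw [coeff_coeff_swap, hF.coeff_succ, finsetSum_coeff, Polynomial.coeff_mul,
      Finset.Nat.sum_antidiagonal_eq_sum_range_succ_mk]
    refine Finset.sum_congr rfl fun n _ => ?_
    rw [coeff_coeff_swap, coeff_coeff_swap]
    obtain ⟨c, hc⟩ := hX n
    rw [hc, hF.coeff_one_coeff_X_mul h0 hX, coeff_X_mul]

/-- If `Y * X = X * g(Y)` modulo `X ^ 2`, then the coefficient of `X ^ i` in `Y * X ^ i` is the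
`i`-fold composite of `g`. -/
theorem coeff_swap_apply_X_pow (hF : IsNormalForm F) (h0 : (F 1 X).coeff 0 = 0)
    (hX : ∀ j, X ∣ (F 1 X).coeff j) (i : ℕ) :
    (Bivariate.swap (F 1 (X ^ (i + 1)))).coeff (i + 1) =
      ((Bivariate.swap (F 1 (X ^ i))).coeff i).comp ((Bivariate.swap (F 1 X)).coeff 1) := by
  set u := (Bivariate.swap (F 1 (X ^ i))).coeff i
  ext j
  rw [coeff_coeff_swap, pow_succ, hF.coeff_mul_of_triangular h0, finsetSum_coeff, comp,
    eval₂_eq_sum, Polynomial.sum_over_range' _ (by simp) (u.natDegree + 1 + (j + 1)) (by omega),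
    finsetSum_coeff]
  refine Finset.sum_subset_zero_on_sdiff
    (Finset.range_mono (show j + 1 ≤ u.natDegree + 1 + (j + 1) by omega)) ?_ ?_
  · intro n hn
    rw [Finset.mem_sdiff, Finset.mem_range, Finset.mem_range] at hn
    rw [coeff_C_mul, ← hF.coeff_one_swap_apply_X h0 hX, coeff_coeff_swap _ 1 j,
      hF.coeff_eq_zero_of_lt h0 n X (by omega), coeff_zero, mul_zero]
  · intro n _
    rw [coeff_C_mul, ← hF.coeff_one_swap_apply_X h0 hX, coeff_coeff_swap _ 1 j,
      coeff_coeff_swap]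
    have ha := hF.X_pow_dvd_coeff h0 hX i 1 1 n
    rw [mul_one] at ha
    have hb := hF.X_dvd_coeff h0 hX n 1 j
    rw [mul_one] at hb
    obtain ⟨a, ha⟩ := ha
    obtain ⟨b, hb⟩ := hb
    have hab := coeff_X_pow_mul (a * b) (i + 1) 0
    have hai := coeff_X_pow_mul a i 0
    rw [zero_add] at hab hai
    rw [ha, hb, coeff_X_mul, show X ^ i * a * (X * b) = X ^ (i + 1) * (a * b) by ring, hab, hai,
      mul_coeff_zero]

/-- If some `Y * X ^ N` vanishes, then `Y * X` is divisible by `X ^ 2` as soon as it is divisible by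
`X`: an iterate of a polynomial `g ≠ 0` with `g(0) = 0` over a domain is nonzero. -/
theorem coeff_coeff_one_eq_zero [IsDomain k] (hF : IsNormalForm F) (h0 : (F 1 X).coeff 0 = 0)
    (hX : ∀ j, X ∣ (F 1 X).coeff j) (hN : ∃ N, F 1 (X ^ N) = 0) (j : ℕ) :
    ((F 1 X).coeff j).coeff 1 = 0 := by
  obtain ⟨N, hN⟩ := hN
  rw [← coeff_coeff_swap]
  by_contra hg
  have hg0 : ((Bivariate.swap (F 1 X)).coeff 1).coeff 0 = 0 := by
    rw [coeff_coeff_swap, h0, coeff_zero]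
  have hne : ∀ i, (Bivariate.swap (F 1 (X ^ i))).coeff i ≠ 0 := fun i => by
    induction i with
    | zero =>
      intro h
      have h' := congrArg (fun p : k[X] => p.coeff 1) h
      simp [coeff_coeff_swap, hF.apply_one] at h'
    | succ i ih =>
      rw [hF.coeff_swap_apply_X_pow h0 hX, Ne, comp_eq_zero_iff, not_or]
      refine ⟨ih, fun h => hg ?_⟩
      rw [h.2, hg0, C_0, coeff_zero]
  exact hne N (by rw [hN, map_zero, coeff_zero])

end IsNormalForm

/-! ### Normal forms of twisting maps -/

section Twisting

variable {k : Type*} [CommRing k]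

/-- The normal form of `Y ^ r * a` given by a twisting map `s`: the element `s (Y ^ r ⊗ a)` of
`k[X] ⊗ k[Y]`, read in `k[X][Y]`. -/
noncomputable def normalForm (s : k[X] ⊗[k] k[X] →ₗ[k] k[X] ⊗[k] k[X]) (r : ℕ) :
    k[X] →ₗ[k] k[X][X] :=
  (polyEquivTensor k k[X]).symm.toLinearMap ∘ₗ s ∘ₗ TensorProduct.mk k k[X] k[X] (X ^ r)

theorem normalForm_apply (s : k[X] ⊗[k] k[X] →ₗ[k] k[X] ⊗[k] k[X]) (r : ℕ) (a : k[X]) :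
    normalForm s r a = (polyEquivTensor k k[X]).symm (s ((X ^ r) ⊗ₜ[k] a)) := rfl

theorem polyEquivTensor_symm_tmul (a p : k[X]) :
    (polyEquivTensor k k[X]).symm (a ⊗ₜ[k] p) = C a * p.map C :=
  (polyEquivTensor_symm_apply_tmul_eq_smul ..).trans (smul_eq_C_mul _)

/-- Induction on `k[X] ⊗ k[Y]` over the elements `a ⊗ Y ^ n`; scalars are absorbed into `a`. -/
theorem tmul_induction {P : k[X] ⊗[k] k[X] → Prop} (z : k[X] ⊗[k] k[X])
    (hadd : ∀ x y, P x → P y → P (x + y)) (htmul : ∀ (a : k[X]) (n : ℕ), P (a ⊗ₜ[k] (X ^ n))) :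
    P z := by
  induction z using TensorProduct.induction_on with
  | zero => simpa using htmul 0 0
  | add x y hx hy => exact hadd x y hx hy
  | tmul a p =>
    induction p using Polynomial.induction_on' with
    | add p q hp hq =>
      rw [TensorProduct.tmul_add]
      exact hadd _ _ hp hq
    | monomial n c =>
      rw [← smul_X_eq_monomial, TensorProduct.tmul_smul, TensorProduct.smul_tmul']
      exact htmul _ n

theorem polyEquivTensor_symm_tmul_X_pow (a : k[X]) (n : ℕ) :
    (polyEquivTensor k k[X]).symm (a ⊗ₜ[k] (X ^ n)) = C a * X ^ n := by
  rw [polyEquivTensor_symm_tmul, Polynomial.map_pow, map_X]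

theorem polyEquivTensor_symm_lTensor_mul' (w : k[X] ⊗[k] k[X]) (n : ℕ) :
    (polyEquivTensor k k[X]).symm ((LinearMap.mul' k k[X]).lTensor k[X]
      (TensorProduct.assoc k k[X] k[X] k[X] (w ⊗ₜ[k] (X ^ n)))) =
      (polyEquivTensor k k[X]).symm w * X ^ n := by
  induction w using TensorProduct.induction_on with
  | zero => simp
  | add x y hx hy => simp only [TensorProduct.add_tmul, map_add, hx, hy, add_mul]
  | tmul a p =>
    simp only [TensorProduct.assoc_tmul, LinearMap.lTensor_tmul, LinearMap.mul'_apply,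
      polyEquivTensor_symm_tmul, Polynomial.map_mul, Polynomial.map_pow, map_X, mul_assoc]

theorem polyEquivTensor_symm_rTensor_mul' (a : k[X]) (w : k[X] ⊗[k] k[X]) :
    (polyEquivTensor k k[X]).symm ((LinearMap.mul' k k[X]).rTensor k[X]
      ((TensorProduct.assoc k k[X] k[X] k[X]).symm (a ⊗ₜ[k] w))) =
      C a * (polyEquivTensor k k[X]).symm w := by
  induction w using TensorProduct.induction_on with
  | zero => simp
  | add x y hx hy => simp only [TensorProduct.tmul_add, map_add, hx, hy, mul_add]
  | tmul b p =>
    simp only [TensorProduct.assoc_symm_tmul, LinearMap.rTensor_tmul, LinearMap.mul'_apply,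
      polyEquivTensor_symm_tmul, C_mul, mul_assoc]

theorem isNormalForm_normalForm {s : k[X] ⊗[k] k[X] →ₗ[k] k[X] ⊗[k] k[X]} (hs : IsTwistingMap s) :
    IsNormalForm (normalForm s) where
  zero_apply a := by
    rw [normalForm_apply, pow_zero, hs.one_tmul, polyEquivTensor_symm_tmul]
    simp
  apply_one r := by
    rw [normalForm_apply, hs.tmul_one, polyEquivTensor_symm_tmul_X_pow, C_1, one_mul]
  succ_apply r a := by
    have h := LinearMap.congr_fun hs.mul_left (((X ^ r) ⊗ₜ[k] X) ⊗ₜ[k] a)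
    simp only [LinearMap.comp_apply, LinearMap.rTensor_tmul, LinearMap.mul'_apply,
      LinearEquiv.coe_coe, TensorProduct.assoc_tmul, LinearMap.lTensor_tmul] at h
    rw [normalForm_apply, normalForm_apply, pow_succ, pow_one, h]
    induction s (X ⊗ₜ[k] a) using tmul_induction with
    | hadd x y hx hy =>
      rw [map_add, Polynomial.sum_add_index _ _ _ (by simp) (by simp [add_mul]), ← hx, ← hy]
      simp only [TensorProduct.tmul_add, map_add]
    | htmul b n =>
      rw [polyEquivTensor_symm_tmul_X_pow, C_mul_X_pow_eq_monomial,
        Polynomial.sum_monomial_index _ _ (by simp), TensorProduct.assoc_symm_tmul,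
        LinearMap.rTensor_tmul, polyEquivTensor_symm_lTensor_mul', normalForm_apply]
  apply_mul r a b := by
    have h := LinearMap.congr_fun hs.mul_right ((X ^ r) ⊗ₜ[k] (a ⊗ₜ[k] b))
    simp only [LinearMap.comp_apply, LinearMap.rTensor_tmul, LinearMap.mul'_apply,
      LinearEquiv.coe_coe, TensorProduct.assoc_symm_tmul, LinearMap.lTensor_tmul] at h
    rw [normalForm_apply, normalForm_apply, h]
    induction s ((X ^ r) ⊗ₜ[k] a) using tmul_induction with
    | hadd x y hx hy =>
      rw [map_add, Polynomial.sum_add_index _ _ _ (by simp) (by simp [add_mul]), ← hx, ← hy]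
      simp only [TensorProduct.add_tmul, map_add]
    | htmul c n =>
      rw [polyEquivTensor_symm_tmul_X_pow, C_mul_X_pow_eq_monomial,
        Polynomial.sum_monomial_index _ _ (by simp), TensorProduct.assoc_tmul,
        LinearMap.lTensor_tmul, polyEquivTensor_symm_rTensor_mul', normalForm_apply]

theorem normalForm_injective : Function.Injective (normalForm (k := k)) := fun s t h => by
  refine TensorProduct.ext (Polynomial.lhom_ext' fun n => LinearMap.ext_ring
    (LinearMap.ext fun a => (polyEquivTensor k k[X]).symm.injective ?_))
  have := LinearMap.congr_fun (congrFun h n) a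
  rw [normalForm_apply, normalForm_apply] at this
  simpa [monomial_one_right_eq_X_pow] using this

theorem coeff_normalForm_one (s : k[X] ⊗[k] k[X] →ₗ[k] k[X] ⊗[k] k[X]) (n : ℕ) (a : k[X]) :
    (normalForm s 1 a).coeff n = alpha s n a := by
  rw [normalForm_apply, pow_one]
  simp only [alpha, LinearMap.comp_apply, LinearEquiv.coe_coe, TensorProduct.mk_apply]
  induction s (X ⊗ₜ[k] a) using tmul_induction with
  | hadd x y hx hy => simp only [map_add, coeff_add, hx, hy]
  | htmul b m =>
    rw [polyEquivTensor_symm_tmul_X_pow, LinearMap.lTensor_tmul, TensorProduct.rid_tmul,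
      lcoeff_apply, coeff_C_mul, coeff_X_pow, coeff_X_pow]
    split_ifs <;> simp

theorem coeff_coeff_ofCoeffs (q : ℕ × ℕ →₀ k) (i j : ℕ) :
    (((polyEquivTensor k k[X]).symm (ofCoeffs q)).coeff j).coeff i = q (i, j) := by
  induction q using Finsupp.induction_linear with
  | zero => simp [ofCoeffs]
  | add p q hp hq =>
    rw [Finsupp.add_apply, ← hp, ← hq, ofCoeffs, Finsupp.sum_add_index' (by simp)
      (by simp [add_smul]), map_add, coeff_add, coeff_add]
    rfl
  | single ij c =>
    rw [ofCoeffs, Finsupp.sum_single_index (by simp), map_smul, polyEquivTensor_symm_tmul_X_pow,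
      coeff_smul, coeff_C_mul, coeff_smul, coeff_X_pow, Finsupp.single_apply]
    obtain ⟨i', j'⟩ := ij
    by_cases hj : j = j' <;> by_cases hi : i = i' <;> simp [hi, hj, coeff_X_pow, Ne.symm]

/-! ### Exchanging the variables -/

/-- For commutative `A` and `B`, passing to the opposite of the twisted tensor product exchanges the
factors and turns `s` into its conjugate under the flips. -/
theorem isTwistingMap_flipConj {A B : Type*} [CommRing A] [Algebra k A] [CommRing B] [Algebra k B]
    {s : B ⊗[k] A →ₗ[k] A ⊗[k] B} (hs : IsTwistingMap s) : IsTwistingMap (flipConj s) := by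
  have happ : ∀ a b, flipConj s (a ⊗ₜ[k] b) = TensorProduct.comm k A B (s (b ⊗ₜ[k] a)) :=
    fun a b => rfl
  refine ⟨fun b => ?_, fun a => ?_, ?_, ?_⟩
  · rw [happ, hs.tmul_one, TensorProduct.comm_tmul]
  · rw [happ, hs.one_tmul, TensorProduct.comm_tmul]
  · refine TensorProduct.ext_threefold fun a a' b => ?_
    have h := LinearMap.congr_fun hs.mul_right (b ⊗ₜ[k] (a' ⊗ₜ[k] a))
    simp only [LinearMap.comp_apply, LinearMap.rTensor_tmul, LinearMap.mul'_apply,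
      LinearEquiv.coe_coe, TensorProduct.assoc_symm_tmul, TensorProduct.assoc_tmul,
      LinearMap.lTensor_tmul, happ] at h ⊢
    rw [mul_comm a a', h]
    induction s (b ⊗ₜ[k] a') using TensorProduct.induction_on with
    | zero => simp
    | add x y hx hy => simp only [TensorProduct.add_tmul, TensorProduct.tmul_add, map_add, hx, hy]
    | tmul x y =>
      simp only [TensorProduct.comm_tmul, TensorProduct.assoc_symm_tmul, LinearMap.rTensor_tmul,
        TensorProduct.assoc_tmul, LinearMap.lTensor_tmul, happ]
      induction s (y ⊗ₜ[k] a) using TensorProduct.induction_on with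
      | zero => simp
      | add v w hv hw => simp only [TensorProduct.add_tmul, TensorProduct.tmul_add, map_add, hv, hw]
      | tmul v w => simp [mul_comm]
  · refine TensorProduct.ext' fun a bb => ?_
    induction bb using TensorProduct.induction_on with
    | zero => simp
    | add x y hx hy => simp only [TensorProduct.tmul_add, map_add, hx, hy]
    | tmul b b' =>
    have h := LinearMap.congr_fun hs.mul_left ((b' ⊗ₜ[k] b) ⊗ₜ[k] a)
    simp only [LinearMap.comp_apply, LinearMap.rTensor_tmul, LinearMap.mul'_apply,
      LinearEquiv.coe_coe, TensorProduct.assoc_symm_tmul, TensorProduct.assoc_tmul,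
      LinearMap.lTensor_tmul, happ] at h ⊢
    rw [mul_comm b b', h]
    induction s (b ⊗ₜ[k] a) using TensorProduct.induction_on with
    | zero => simp
    | add x y hx hy => simp only [TensorProduct.add_tmul, TensorProduct.tmul_add, map_add, hx, hy]
    | tmul x y =>
      simp only [TensorProduct.comm_tmul, TensorProduct.assoc_symm_tmul, LinearMap.rTensor_tmul,
        TensorProduct.assoc_tmul, LinearMap.lTensor_tmul, happ]
      induction s (b' ⊗ₜ[k] x) using TensorProduct.induction_on with
      | zero => simp
      | add v w hv hw => simp only [TensorProduct.add_tmul, TensorProduct.tmul_add, map_add, hv, hw]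
      | tmul v w => simp [mul_comm]

theorem flipConj_injective {A B : Type*} [CommRing A] [Algebra k A] [CommRing B] [Algebra k B] :
    Function.Injective (flipConj : (B ⊗[k] A →ₗ[k] A ⊗[k] B) → _) := fun s t h => by
  refine TensorProduct.ext' fun b a => (TensorProduct.comm k A B).injective ?_
  exact LinearMap.congr_fun h (a ⊗ₜ[k] b)

theorem comm_ofCoeffs (q : ℕ × ℕ →₀ k) :
    TensorProduct.comm k k[X] k[X] (ofCoeffs q) =
      ofCoeffs (q.equivMapDomain (Equiv.prodComm ℕ ℕ)) := by
  rw [ofCoeffs, ofCoeffs, Finsupp.equivMapDomain_eq_mapDomain,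
    Finsupp.sum_mapDomain_index (by simp) (by simp [add_smul]), map_finsuppSum]
  simp

/-! ### Upper bounded twisting maps -/

theorem eq_zero_and_unique_of_isUpperBounded [IsDomain k] (q : ℕ × ℕ →₀ k)
    (hq : ∀ i : ℕ, q (i, 0) = 0 ∧ q (i, 1) = 0)
    (s : k[X] ⊗[k] k[X] →ₗ[k] k[X] ⊗[k] k[X]) (hs : IsTwistingMap s) (hb : IsUpperBounded s)
    (hsq : s (X ⊗ₜ[k] X) = ofCoeffs q) :
    (∀ j : ℕ, q (0, j) = 0 ∧ q (1, j) = 0) ∧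
      ∀ t : k[X] ⊗[k] k[X] →ₗ[k] k[X] ⊗[k] k[X],
        IsTwistingMap t → t (X ⊗ₜ[k] X) = ofCoeffs q → t = s := by
  have hF := isNormalForm_normalForm hs
  have hcoeff : ∀ i j, ((normalForm s 1 X).coeff j).coeff i = q (i, j) := fun i j => by
    rw [normalForm_apply, pow_one, hsq, coeff_coeff_ofCoeffs]
  have h0 : (normalForm s 1 X).coeff 0 = 0 := Polynomial.ext fun i => by
    rw [hcoeff, (hq i).1, coeff_zero]
  have h1 : (normalForm s 1 X).coeff 1 = 0 := Polynomial.ext fun i => by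
    rw [hcoeff, (hq i).2, coeff_zero]
  refine ⟨?_, fun t ht htq => ?_⟩
  · obtain ⟨N, hN⟩ := hb
    have hpow := hF.exists_apply_X_pow_eq_zero h0 h1
      ⟨N, fun n hn a => by rw [coeff_normalForm_one, hN n hn, LinearMap.zero_apply]⟩
    have hc0 := hF.coeff_coeff_zero_eq_zero h0 h1 hpow
    have hc1 := hF.coeff_coeff_one_eq_zero h0 (fun j => X_dvd_iff.2 (hc0 j)) hpow
    exact fun j => ⟨hcoeff 0 j ▸ hc0 j, hcoeff 1 j ▸ hc1 j⟩
  · refine (normalForm_injective (hF.eq_of_apply_X_eq (isNormalForm_normalForm ht) h0 h1 ?_)).symm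
    rw [normalForm_apply, normalForm_apply, pow_one, hsq, htq]

end Twisting

end TwistingMap

theorem theorem3p4 {k : Type*} [CommRing k] [IsDomain k] (q : ℕ × ℕ →₀ k) :
    -- item (1)
    ((∀ i : ℕ, q (i, 0) = 0 ∧ q (i, 1) = 0) →
      ∀ s : Polynomial k ⊗[k] Polynomial k →ₗ[k] Polynomial k ⊗[k] Polynomial k,
        IsTwistingMap s → TwistingMap.IsUpperBounded s →
        s (Polynomial.X ⊗ₜ[k] Polynomial.X) = TwistingMap.ofCoeffs q →
        (∀ j : ℕ, q (0, j) = 0 ∧ q (1, j) = 0) ∧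
        -- uniqueness of `s`
        ∀ t : Polynomial k ⊗[k] Polynomial k →ₗ[k] Polynomial k ⊗[k] Polynomial k,
          IsTwistingMap t →
          t (Polynomial.X ⊗ₜ[k] Polynomial.X) = TwistingMap.ofCoeffs q → t = s) ∧
    -- item (2)
    ((∀ j : ℕ, q (0, j) = 0 ∧ q (1, j) = 0) →
      ∀ s : Polynomial k ⊗[k] Polynomial k →ₗ[k] Polynomial k ⊗[k] Polynomial k,
        IsTwistingMap s → TwistingMap.IsLowerBounded s →
        s (Polynomial.X ⊗ₜ[k] Polynomial.X) = TwistingMap.ofCoeffs q →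
        (∀ i : ℕ, q (i, 0) = 0 ∧ q (i, 1) = 0) ∧
        -- uniqueness of `s`
        ∀ t : Polynomial k ⊗[k] Polynomial k →ₗ[k] Polynomial k ⊗[k] Polynomial k,
          IsTwistingMap t →
          t (Polynomial.X ⊗ₜ[k] Polynomial.X) = TwistingMap.ofCoeffs q → t = s) := by
  refine ⟨TwistingMap.eq_zero_and_unique_of_isUpperBounded q, fun hq s hs hb hsq => ?_⟩
  have hflip : ∀ t : Polynomial k ⊗[k] Polynomial k →ₗ[k] Polynomial k ⊗[k] Polynomial k,
      t (Polynomial.X ⊗ₜ[k] Polynomial.X) = TwistingMap.ofCoeffs q →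
      TwistingMap.flipConj t (Polynomial.X ⊗ₜ[k] Polynomial.X) =
        TwistingMap.ofCoeffs (q.equivMapDomain (Equiv.prodComm ℕ ℕ)) := fun t ht => by
    rw [← TwistingMap.comm_ofCoeffs, ← ht]
    rfl
  obtain ⟨hzero, huniq⟩ := TwistingMap.eq_zero_and_unique_of_isUpperBounded
    (q.equivMapDomain (Equiv.prodComm ℕ ℕ)) hq (TwistingMap.flipConj s)
    (TwistingMap.isTwistingMap_flipConj hs) hb (hflip s hsq)
  exact ⟨hzero, fun t ht htq => TwistingMap.flipConj_injective
    (huniq _ (TwistingMap.isTwistingMap_flipConj ht) (hflip t htq))⟩
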